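/- There is a universal constant $C>0$ such that for all integers $d\ge 2$ and $n\ge 1$ there is a set $U\subseteq\mathbb{R}^d$ with $|U|=n$ such that \[R(\mathrm{PromiseCSD}_U)\ \ge\ C\,d\log(n/d)\qquad\text{and}\qquad R(\mathrm{CSD}_U)\ \ge\ C\,d\log(n/d).\] Here Alice and Bob hold sets $X\subseteq U$ and $Y\subseteq U$, respectively. The function $\mathrm{CSD}_U(X,Y)$ is $0$ if $\mathrm{conv}(X)\cap\mathrm{conv}(Y)\neq\emptyset$ and $1$ otherwise. The partial function $\mathrm{PromiseCSD}_U(X,Y)$ is $0$ if $X\cap Y\ne\emptyset$, is $1$ if $\mathrm{conv}(X)\cap\mathrm{conv}(Y)=\emptyset$, and is undefined otherwise. For a (possibly partial) Boolean function $f$, $R(f)$ denotes its randomized two-party communication complexity with error $1/3$: the least worst-case number of bits exchanged by a public-coin randomized protocol that, on every input in the domain of $f$, outputs the value of $f$ with probability at least $2/3$. (Since private-coin protocols are a special case of public-coin ones, the same lower bounds hold for private-coin protocols.) -/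

import Mathlib

namespace ConvexSetDisjointness

/-- Deterministic two-party communication protocols: a binary tree in which every internal node is
owned by Alice or by Bob and labelled by a function of the owner's input giving the bit that the
owner sends; every leaf is labelled by the output. -/
inductive Protocol (α β : Type) : Type where
  | leaf (out : Bool) : Protocol α β
  | alice (bit : α → Bool) (next : Bool → Protocol α β) : Protocol α β
  | bob (bit : β → Bool) (next : Bool → Protocol α β) : Protocol α β

namespace Protocol

variable {α β : Type}

/-- The output of the protocol on a pair of inputs. -/
def eval : Protocol α β → α → β → Bool
  | leaf out, _, _ => out
  | alice bit next, x, y => (next (bit x)).eval x y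
  | bob bit next, x, y => (next (bit y)).eval x y

/-- The cost of the protocol: the height of its tree, i.e. the largest number of bits sent. -/
def cost : Protocol α β → ℕ
  | leaf _ => 0
  | alice _ next => max (next false).cost (next true).cost + 1
  | bob _ next => max (next false).cost (next true).cost + 1

end Protocol

/-- A public-coin randomized protocol is a probability distribution `μ` over deterministic protocols
`P ω`. (A private-coin protocol is a special case: `ω` is the pair of random strings of the two
parties.) It computes the partial Boolean function `f` with error `ε` if on every input pair in the
domain of `f` the output is wrong with probability at most `ε`. -/
def ComputesWithError {α β Ω : Type} (μ : PMF Ω) (P : Ω → Protocol α β)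
    (f : α → β → Option Bool) (ε : ENNReal) : Prop :=
  ∀ (x : α) (y : β) (b : Bool), f x y = some b →
    μ.toOuterMeasure {ω | (P ω).eval x y ≠ b} ≤ ε

/-- The randomized communication complexity `R_ε(f)` of a partial Boolean function `f` (`none` means
that the input pair is outside the domain): the least worst-case cost, over all inputs and all coin
outcomes, of a randomized protocol computing `f` with error `ε`. -/
noncomputable def randCC {α β : Type} (ε : ENNReal) (f : α → β → Option Bool) : ℕ :=
  sInf {c : ℕ | ∃ (Ω : Type) (μ : PMF Ω) (P : Ω → Protocol α β),
    (∀ ω, (P ω).cost ≤ c) ∧ ComputesWithError μ P f ε}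

/-- The infimum in `randCC` is over a nonempty set. -/
theorem randCC_set_nonempty {α β : Type} [Finite α] (ε : ENNReal) (f : α → β → Option Bool) :
    {c : ℕ | ∃ (Ω : Type) (μ : PMF Ω) (P : Ω → Protocol α β),
      (∀ ω, (P ω).cost ≤ c) ∧ ComputesWithError μ P f ε}.Nonempty := by
  classical
  have key : ∀ S : Finset α, ∃ P : Protocol α β, ∀ x ∈ S, ∀ y, P.eval x y = (f x y).getD true := by
    intro S
    induction S using Finset.induction_on with
    | empty => exact ⟨.leaf true, by simp⟩
    | insert a S _ ih =>
      obtain ⟨Q, hQ⟩ := ih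
      refine ⟨.alice (fun x => decide (x = a)) (fun c => if c then
        .bob (fun y => (f a y).getD true) (fun b => .leaf b) else Q), fun x hx y => ?_⟩
      by_cases hxa : x = a
      · subst hxa
        simp [Protocol.eval]
      · have hxS : x ∈ S := by simpa [hxa] using hx
        simp [Protocol.eval, hxa, hQ x hxS y]
  have := Fintype.ofFinite α
  obtain ⟨P, hP⟩ := key Finset.univ
  refine ⟨P.cost, Unit, PMF.pure (), fun _ => P, fun _ => le_rfl, fun x y b hb => ?_⟩
  simp [hP x (Finset.mem_univ x) y, hb]

/-- The convex hull in `ℝ^d` of a subset `X` of the finite domain `U`. -/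
def hull {d : ℕ} {U : Finset (Fin d → ℝ)} (X : Set U) : Set (Fin d → ℝ) :=
  convexHull ℝ (Subtype.val '' X)

open Classical in
/-- `CSD_U : 2^U × 2^U → {0,1}` (a total function): `0` if the convex hulls intersect, else `1`. -/
noncomputable def CSD {d : ℕ} (U : Finset (Fin d → ℝ)) (X Y : Set U) : Option Bool :=
  if (hull X ∩ hull Y).Nonempty then some false else some true

open Classical in
/-- The partial function `PromiseCSD_U`: `0` if the sets intersect, `1` if their convex hulls are
disjoint, and undefined otherwise. -/
noncomputable def PromiseCSD {d : ℕ} (U : Finset (Fin d → ℝ)) (X Y : Set U) : Option Bool :=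
  if (X ∩ Y).Nonempty then some false
  else if hull X ∩ hull Y = ∅ then some true
  else none

end ConvexSetDisjointness

/-! ### Gibbs' inequality, sequential weights and a counting inequality for rectangles. -/

namespace ConvexSetDisjointness

open Finset

/-! Let `U` lie on the moment curve. If Bob holds at most d/2 points of it, the polynomial ∏ (t -
y)^2 over his points has degree at most d, so it is an affine function on the curve that vanishes on
his points and is positive on all others. Hulls then meet only if the sets do
(`disjoint_convexHull_momentCurve`), and lopsided disjointness embeds: in each of k ≤ d/2 blocks of
m pairs, Bob holds one element and Alice one element of every pair.

The bound of order k log m for that problem is a corruption argument (`corruption`): a rectangle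
with at least an m^(-k/1000) fraction of the pairs without a hit has, on average over i, at least
3/5 as many pairs whose only hit is in block i. To see this, fix Alice's blocks before i and Bob's
blocks after i. The pairs with no hit outside block i again form a rectangle, and there hits and
non-hits at i nearly balance unless Alice's bit at Bob's position is biased (`card_fiber_sub_le`).

Such bias is rare by two uses of Gibbs' inequality. Predicting Alice's bits by their conditional
means shows that few bits are biased (`sum_sq_bias_le`). Predicting Bob's positions with weights
tilted towards biased bits shows that Bob seldom selects one of these few
(`mul_sum_sq_bias_selected_le`). -/

/-- Gibbs' inequality for the uniform distribution on a finite set. -/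
theorem card_mul_log_card_le {α : Type*} (E : Finset α) (Q : α → ℝ) (hpos : ∀ e ∈ E, 0 < Q e)
    (hsum : ∑ e ∈ E, Q e ≤ 1) :
    (#E : ℝ) * Real.log #E ≤ ∑ e ∈ E, -Real.log (Q e) := by
  rcases E.eq_empty_or_nonempty with rfl | hE
  · simp
  have hc : (0 : ℝ) < #E := by exact_mod_cast hE.card_pos
  have h : ∑ e ∈ E, (Real.log (Q e) + Real.log #E) ≤ ∑ e ∈ E, (Q e * #E - 1) :=
    sum_le_sum fun e he => by
      rw [← Real.log_mul (hpos e he).ne' hc.ne']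
      exact Real.log_le_sub_one_of_pos (mul_pos (hpos e he) hc)
  rw [sum_add_distrib, sum_sub_distrib, ← sum_mul] at h
  simp only [sum_const, nsmul_eq_mul, mul_one] at h
  rw [sum_neg_distrib]
  nlinarith

/-- A product of conditional probability weights, each depending on the earlier coordinates only,
has total mass one. -/
theorem sum_prod_sequential {α : Type*} [Fintype α] [DecidableEq α] [Inhabited α] :
    ∀ (k : ℕ) (q : Fin k → α → (Fin k → α) → ℝ),
      (∀ i x X X', (∀ l < i, X l = X' l) → q i x X = q i x X') →
      (∀ i X, ∑ x, q i x X = 1) → ∑ X : Fin k → α, ∏ i, q i (X i) X = 1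
  | 0, q, _, _ => by simp
  | k + 1, q, hdep, hsum => by
    rw [← (Fin.consEquiv fun _ : Fin (k + 1) => α).sum_comp, Fintype.sum_prod_type]
    -- The weight of coordinate 0 depends on no coordinate, so `default` stands for an arbitrary
    -- `X`.
    rw [← hsum 0 default]
    refine sum_congr rfl fun x _ => ?_
    have ih := sum_prod_sequential k (fun i z X => q i.succ z (Fin.cons x X : Fin (k + 1) → α))
      (fun i z X X' h => hdep _ _ _ _ fun l hl => by
        induction l using Fin.cases with
        | zero => simp
        | succ l => simpa using h l (by simpa using hl))
      (fun i X => hsum _ _)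
    calc ∑ X : Fin k → α, ∏ i, q i ((Fin.consEquiv fun _ => α) (x, X) i)
          ((Fin.consEquiv fun _ => α) (x, X))
        = ∑ X : Fin k → α, q 0 x default * ∏ i : Fin k, q i.succ (X i) (Fin.cons x X) := by
          refine sum_congr rfl fun X _ => ?_
          rw [Fin.prod_univ_succ]
          congr 1
          exact hdep 0 _ _ _ fun l hl => absurd hl (Fin.not_lt_zero l)
      _ = q 0 x default := by rw [← mul_sum, ih, mul_one]

/-- The same with weights that depend on the later coordinates only. -/
theorem sum_prod_sequential_rev {α : Type*} [Fintype α] [DecidableEq α] [Inhabited α] (k : ℕ)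
    (q : Fin k → α → (Fin k → α) → ℝ)
    (hdep : ∀ i x X X', (∀ l, i < l → X l = X' l) → q i x X = q i x X')
    (hsum : ∀ i X, ∑ x, q i x X = 1) : ∑ X : Fin k → α, ∏ i, q i (X i) X = 1 := by
  have h := sum_prod_sequential k (fun i x X => q i.rev x (X ∘ Fin.rev))
    (fun i x X X' h => hdep _ _ _ _ fun l hl => h _ (by
      rw [← Fin.rev_lt_rev]; simpa using hl)) (fun i X => hsum _ _)
  rw [← h, ← (Equiv.arrowCongr Fin.revPerm (Equiv.refl α)).sum_comp]
  refine sum_congr rfl fun X _ => ?_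
  rw [← Equiv.prod_comp Fin.revPerm]
  refine prod_congr rfl fun i _ => ?_
  simp only [Equiv.arrowCongr_apply, Equiv.coe_refl, Fin.revPerm_symm, Function.comp_apply, id,
    Fin.revPerm_apply, Fin.rev_rev]
  rfl

/-- If a relation `R` on `S × T` is such that a random `R`-pair `(s, t)` and an independent random
`R`-pair `(s', t')` satisfy `R s' t` with conditional probability close to `1/2` given `t`, then
nearly as many pairs violate `R` as satisfy it. -/
theorem card_related_sub_le_card_unrelated {α β : Type*} (S : Finset α) (T : Finset β)
    (R : α → β → Prop) [∀ s t, Decidable (R s t)] (p : β → ℝ)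
    (hp : ∀ t ∈ T, p t * #{e ∈ S ×ˢ T | R e.1 e.2} = #{e ∈ S ×ˢ T | R e.1 e.2 ∧ ¬ R e.1 t}) :
    (#{e ∈ S ×ˢ T | R e.1 e.2} : ℝ) - 8 * ∑ e ∈ S ×ˢ T with R e.1 e.2, max (1 / 2 - p e.2) 0
      ≤ #{e ∈ S ×ˢ T | ¬ R e.1 e.2} := by
  set D : ℝ := ((#{e ∈ S ×ˢ T | R e.1 e.2} : ℕ) : ℝ) with hD
  have hDnn : 0 ≤ D := by positivity
  rcases hDnn.eq_or_lt with h0 | hDpos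
  · have : 0 ≤ ∑ e ∈ S ×ˢ T with R e.1 e.2, max (1 / 2 - p e.2) 0 :=
      sum_nonneg fun _ _ => le_max_right _ _
    have h2 : (0 : ℝ) ≤ #{e ∈ S ×ˢ T | ¬ R e.1 e.2} := Nat.cast_nonneg _
    have : D = 0 := h0.symm
    linarith
  let z : α → ℝ := fun s => ∑ t ∈ T, if R s t then 1 else 0
  let o : α → ℝ := fun s => ∑ t ∈ T, if R s t then 0 else 1
  have hzo : ∀ s, z s + o s = #T := fun s => by
    rw [← sum_add_distrib]
    rw [sum_congr rfl (g := fun _ => (1 : ℝ))]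
    · simp
    · intro t _; split_ifs <;> simp
  have ho0 : ∀ s, 0 ≤ o s := fun s => sum_nonneg fun t _ => by split_ifs <;> simp
  have hDz : D = ∑ s ∈ S, z s := by
    rw [hD, card_filter, Nat.cast_sum, sum_product]
    simp [z]
  have hUo : (#{e ∈ S ×ˢ T | ¬ R e.1 e.2} : ℝ) = ∑ s ∈ S, o s := by
    rw [card_filter, Nat.cast_sum, sum_product]
    refine sum_congr rfl fun s _ => sum_congr rfl fun t _ => ?_
    split_ifs <;> simp_all
  have hpD : ∀ t ∈ T, p t * D = ∑ s ∈ S, z s * (if R s t then 0 else 1) := fun t ht => by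
    rw [hp t ht, card_filter, Nat.cast_sum, sum_product]
    refine sum_congr rfl fun s _ => ?_
    rw [sum_mul]
    refine sum_congr rfl fun t' _ => ?_
    split_ifs <;> simp_all
  have hT : (0 : ℝ) < #T := by
    have : T.Nonempty := by
      by_contra h
      rw [not_nonempty_iff_eq_empty] at h
      subst h
      simp [hD] at hDpos
    exact_mod_cast this.card_pos
  -- Double counting gives D ∑ p = ∑ z o, and 4 z o ≤ (z + o)^2 = #T (z + o) for each s.
  have h1 : D * (4 * ∑ t ∈ T, p t - #T) ≤ #T * ∑ s ∈ S, o s := by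
    have h2 : D * ∑ t ∈ T, p t = ∑ s ∈ S, z s * o s := by
      rw [mul_sum]
      simp only [o, mul_sum]
      rw [sum_comm]
      exact sum_congr rfl fun t ht => by rw [mul_comm, hpD t ht]
    have h3 : ∑ s ∈ S, (4 * (z s * o s) - z s * #T) ≤ ∑ s ∈ S, #T * o s :=
      sum_le_sum fun s _ => by rw [← hzo s]; nlinarith [sq_nonneg (z s - o s)]
    rw [sum_sub_distrib, ← mul_sum, ← mul_sum, ← sum_mul, ← hDz] at h3
    nlinarith
  -- Change of measure: z ≤ #T bounds D (1 - p t) by #T times the number of s related to t, so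
  -- deficits under uniform t are controlled by deficits along related pairs.
  have h4 : D * ∑ t ∈ T, (1 - p t) * max (1 / 2 - p t) 0
      ≤ #T * ∑ e ∈ S ×ˢ T with R e.1 e.2, max (1 / 2 - p e.2) 0 := by
    rw [sum_filter, sum_product, sum_comm, mul_sum, mul_sum]
    refine sum_le_sum fun t ht => ?_
    rw [mul_sum, ← mul_assoc, mul_sub, mul_one, mul_comm D (p t), hpD t ht, hDz, ← sum_sub_distrib,
      sum_mul]
    refine sum_le_sum fun s _ => ?_
    have hm : 0 ≤ max (1 / 2 - p t) 0 := le_max_right _ _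
    have hzT : z s ≤ #T := by linarith [hzo s, ho0 s]
    split_ifs
    · simpa using mul_le_mul_of_nonneg_right hzT hm
    · simp
  -- Where the deficit is nonzero, p t < 1/2 and hence 1 < 2 (1 - p t).
  have h5 : ∑ t ∈ T, max (1 / 2 - p t) 0 ≤ ∑ t ∈ T, 2 * ((1 - p t) * max (1 / 2 - p t) 0) :=
    sum_le_sum fun t _ => by
      rcases le_total (1 / 2 - p t) 0 with h | h
      · rw [max_eq_right h]; simp
      · rw [max_eq_left h]; nlinarith
  have h6 : (#T : ℝ) / 2 - ∑ t ∈ T, max (1 / 2 - p t) 0 ≤ ∑ t ∈ T, p t := by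
    have : ∑ t ∈ T, (1 / 2 - max (1 / 2 - p t) 0) ≤ ∑ t ∈ T, p t :=
      sum_le_sum fun t _ => by linarith [le_max_left (1 / 2 - p t) 0]
    rw [sum_sub_distrib, sum_const, nsmul_eq_mul] at this
    linarith
  rw [← mul_sum] at h5
  rw [hUo]
  refine le_of_mul_le_mul_left ?_ hT
  nlinarith [mul_le_mul_of_nonneg_left h6 hDpos.le, mul_le_mul_of_nonneg_left h5 hDpos.le]

end ConvexSetDisjointness

/-! ### Lopsided disjointness and entropy bounds for biased bits. -/

namespace ConvexSetDisjointness

open Finset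

variable {k m : ℕ}

/-- Alice's `x` selects one element of each of the pairs `{(j, true), (j, false)}` in each block,
Bob's `y` selects one element of each block: do they agree in block `l`? -/
def hits (X : Fin k → Fin m → Bool) (Y : Fin k → Fin m × Bool) (l : Fin k) : Bool :=
  X l (Y l).1 == (Y l).2

/-- The pairs in the rectangle `A × B` with hit pattern `s`. -/
def cell (A : Finset (Fin k → Fin m → Bool)) (B : Finset (Fin k → Fin m × Bool))
    (s : Fin k → Bool) : Finset ((Fin k → Fin m → Bool) × (Fin k → Fin m × Bool)) :=
  {e ∈ A ×ˢ B | hits e.1 e.2 = s}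

/-- The pattern without hits. -/
def noHit : Fin k → Bool := fun _ => false

/-- The pattern with a single hit, in block `i`. -/
def hitAt (i : Fin k) : Fin k → Bool := fun l => decide (l = i)

/-- In each block, Alice's bits and Bob's position are free and the pattern then determines Bob's
bit. All patterns are therefore equally frequent. -/
theorem card_cell_univ (s : Fin k → Bool) :
    #(cell (k := k) (m := m) univ univ s) = (2 ^ m * m) ^ k := by
  have h : Fintype.card (Fin k → (Fin m → Bool) × Fin m) = (2 ^ m * m) ^ k := by simp
  rw [← h, ← card_univ]
  refine card_nbij' (fun e l => (e.1 l, (e.2 l).1))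
    (fun f => (fun l => (f l).1, fun l => ((f l).2, (f l).1 (f l).2 == s l))) ?_ ?_ ?_ ?_
  · simp
  · intro f _
    simp only [cell, coe_filter, Set.mem_ofPred_eq, univ_product_univ, mem_univ, true_and]
    funext l
    simp only [hits]
    cases (f l).1 (f l).2 <;> cases s l <;> rfl
  · rintro ⟨X, Y⟩ he
    simp only [cell, coe_filter, Set.mem_ofPred_eq, univ_product_univ, mem_univ, true_and] at he
    subst he
    simp only [Prod.mk.injEq, true_and]
    funext l
    refine Prod.ext rfl ?_
    simp only [hits]
    cases X l (Y l).1 <;> cases (Y l).2 <;> rfl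
  · intro f _
    rfl

variable [NeZero m]

/-- The blocks of Alice's input before `i` and those of Bob's input after `i`. -/
def context (i : Fin k) (e : (Fin k → Fin m → Bool) × (Fin k → Fin m × Bool)) :
    (Fin k → Fin m → Bool) × (Fin k → Fin m × Bool) :=
  (fun l => if l < i then e.1 l else fun _ => false, fun l => if i < l then e.2 l else (0, false))

theorem context_eq_iff (i : Fin k) (e e' : (Fin k → Fin m → Bool) × (Fin k → Fin m × Bool)) :
    context i e = context i e' ↔
      (∀ l < i, e.1 l = e'.1 l) ∧ ∀ l, i < l → e.2 l = e'.2 l := by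
  simp only [context, Prod.mk.injEq, funext_iff (β := fun _ : Fin k => _)]
  refine and_congr (forall_congr' fun l => ?_) (forall_congr' fun l => ?_) <;>
    split_ifs with h <;> simp [h]

/-- The sign of a bit. -/
def sgn (b : Bool) : ℝ := if b then 1 else -1

theorem abs_sgn (b : Bool) : |sgn b| = 1 := by cases b <;> simp [sgn]

/-- The mean of the sign of Alice's bit `j` of block `i` over the pairs in `E` with a given
context. -/
noncomputable def bias (E : Finset ((Fin k → Fin m → Bool) × (Fin k → Fin m × Bool))) (i : Fin k)
    (j : Fin m) (c : (Fin k → Fin m → Bool) × (Fin k → Fin m × Bool)) : ℝ :=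
  (∑ e ∈ E with context i e = c, sgn (e.1 i j)) / #{e ∈ E | context i e = c}

variable (E : Finset ((Fin k → Fin m → Bool) × (Fin k → Fin m × Bool)))

theorem bias_mul_card (i : Fin k) (j : Fin m)
    (c : (Fin k → Fin m → Bool) × (Fin k → Fin m × Bool)) :
    bias E i j c * #{e ∈ E | context i e = c} = ∑ e ∈ E with context i e = c, sgn (e.1 i j) := by
  rcases ({e ∈ E | context i e = c}).eq_empty_or_nonempty with h | h
  · simp [h]
  · exact div_mul_cancel₀ _ (by exact_mod_cast h.card_pos.ne')

theorem abs_bias_le (i : Fin k) (j : Fin m)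
    (c : (Fin k → Fin m → Bool) × (Fin k → Fin m × Bool)) : |bias E i j c| ≤ 1 := by
  rw [bias, abs_div, Nat.abs_cast]
  refine div_le_one_of_le₀ ((abs_sum_le_sum_abs _ _).trans ?_) (Nat.cast_nonneg _)
  simp [abs_sgn]

/-- Tower property: on each fibre of the context, the sign may be replaced by its mean. -/
theorem sum_sgn_mul_eq (i : Fin k) (j : Fin m)
    (φ : (Fin k → Fin m → Bool) × (Fin k → Fin m × Bool) → ℝ) :
    ∑ e ∈ E, sgn (e.1 i j) * φ (context i e) =
      ∑ e ∈ E, bias E i j (context i e) * φ (context i e) := by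
  rw [← sum_fiberwise E (context i), ← sum_fiberwise E (context i)]
  refine sum_congr rfl fun c _ => ?_
  have h : ∀ f : (Fin k → Fin m → Bool) × (Fin k → Fin m × Bool) → ℝ,
      ∑ e ∈ E with context i e = c, f e * φ (context i e) =
        (∑ e ∈ E with context i e = c, f e) * φ c := fun f => by
    rw [sum_mul]
    exact sum_congr rfl fun e he => by rw [(mem_filter.1 he).2]
  rw [h, h fun e => bias E i j (context i e), ← bias_mul_card]
  congr 1
  rw [sum_congr rfl (g := fun _ => bias E i j c)
    fun e he => by rw [(mem_filter.1 he).2], sum_const, nsmul_eq_mul, mul_comm]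

theorem le_log_one_add_quarter {t : ℝ} (ht : |t| ≤ 1) :
    t / 4 - t ^ 2 / 8 ≤ Real.log (1 + t / 4) := by
  have h1 := (abs_le.1 ht).1
  have h3 : 0 < 1 + t / 4 := by linarith
  refine le_trans ?_ (Real.one_sub_inv_le_log_of_pos h3)
  rw [le_sub_iff_add_le, ← le_sub_iff_add_le', inv_le_iff_one_le_mul₀ h3]
  nlinarith [mul_nonneg (sq_nonneg t) (by linarith : (0 : ℝ) ≤ 2 + t)]

/-- Few of Alice's bits are biased on average over a large set. -/
theorem sum_sq_bias_le :
    ∑ e ∈ E, ∑ i, ∑ j, bias E i j (context i e) ^ 2 ≤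
      8 * (#E * (k * Real.log (2 * m) + k * (m * Real.log 2) - Real.log #E)) := by
  have hm : (0 : ℝ) < 2 * m := by have := NeZero.pos m; positivity
  -- The predicted probability of a bit, with the bias damped by 4 to stay away from zero.
  let u (i : Fin k) (j : Fin m) (x : Fin m → Bool)
      (e : (Fin k → Fin m → Bool) × (Fin k → Fin m × Bool)) : ℝ :=
    (1 + sgn (x j) * bias E i j (context i e) / 4) / 2
  have hb : ∀ i j (x : Fin m → Bool) e, |sgn (x j) * bias E i j (context i e)| ≤ 1 := fun i j x e => by
    rw [abs_mul, abs_sgn, one_mul]; exact abs_bias_le _ _ _ _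
  have hu : ∀ i j x e, 0 < u i j x e := fun i j x e => by
    have := (abs_le.1 (hb i j x e)).1
    simp only [u]; linarith
  -- Bob's blocks are coded uniformly over all 2m choices. Ignoring a no-hit constraint costs only k
  -- log 2.
  let Q (e : (Fin k → Fin m → Bool) × (Fin k → Fin m × Bool)) : ℝ :=
    ((2 * m : ℝ)⁻¹) ^ k * ∏ i, ∏ j, u i j (e.1 i) e
  have hQ : ∀ e, 0 < Q e := fun e =>
    mul_pos (by positivity) (prod_pos fun i _ => prod_pos fun j _ => hu _ _ _ _)
  have hsum : ∑ e ∈ E, Q e ≤ 1 := by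
    refine (sum_le_univ_sum_of_nonneg fun e => (hQ e).le).trans_eq ?_
    rw [Fintype.sum_prod_type_right]
    have h1 : ∀ Y : Fin k → Fin m × Bool, ∑ X : Fin k → Fin m → Bool, Q (X, Y) =
        ((2 * m : ℝ)⁻¹) ^ k := fun Y => by
      simp only [Q]
      rw [← mul_sum, sum_prod_sequential k (fun i x X => ∏ j, u i j x (X, Y)), mul_one]
      · intro i x X X' h
        refine prod_congr rfl fun j _ => ?_
        simp only [u]
        rw [(context_eq_iff i (X, Y) (X', Y)).2 ⟨h, fun _ _ => rfl⟩]
      · intro i X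
        have := prod_univ_sum (fun _ : Fin m => (univ : Finset Bool))
          (fun j b => (1 + sgn b * bias E i j (context i (X, Y)) / 4) / 2)
        rw [Fintype.piFinset_univ] at this
        simp only [u]
        rw [← this]
        refine prod_eq_one fun j _ => ?_
        simp only [Fintype.sum_bool, sgn]
        simp only [if_true, Bool.false_eq_true, if_false]
        ring
    rw [sum_congr rfl fun Y _ => h1 Y]
    simp only [sum_const, nsmul_eq_mul, card_univ, Fintype.card_pi, Fintype.card_prod,
      Fintype.card_fin, Fintype.card_bool, prod_const]
    push_cast
    rw [← mul_pow, mul_comm (m : ℝ) 2, mul_inv_cancel₀ hm.ne', one_pow]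
  have hG := card_mul_log_card_le E Q (fun e _ => hQ e) hsum
  have hlog : ∀ e, -Real.log (Q e) ≤ k * Real.log (2 * m) + k * (m * Real.log 2) -
      ∑ i, ∑ j, (sgn (e.1 i j) * bias E i j (context i e) / 4 -
        bias E i j (context i e) ^ 2 / 8) := fun e => by
    have h1 : Real.log (Q e) = -(k * Real.log (2 * m)) + ∑ i, ∑ j, Real.log (u i j (e.1 i) e) := by
      simp only [Q]
      rw [Real.log_mul (by positivity) (prod_ne_zero_iff.2 fun i _ => prod_ne_zero_iff.2
        fun j _ => (hu _ _ _ _).ne'), Real.log_pow, Real.log_inv, mul_neg,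
        Real.log_prod fun i _ => prod_ne_zero_iff.2 fun j _ => (hu _ _ _ _).ne']
      congr 1
      exact sum_congr rfl fun i _ => Real.log_prod fun j _ => (hu _ _ _ _).ne'
    have h2 : ∑ i : Fin k, ∑ j : Fin m, (sgn (e.1 i j) * bias E i j (context i e) / 4 -
        bias E i j (context i e) ^ 2 / 8 - Real.log 2) ≤ ∑ i, ∑ j, Real.log (u i j (e.1 i) e) :=
      sum_le_sum fun i _ => sum_le_sum fun j _ => by
        simp only [u]
        have h3 := (abs_le.1 (hb i j (e.1 i) e)).1
        rw [Real.log_div (by linarith) two_ne_zero]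
        have h4 := le_log_one_add_quarter (hb i j (e.1 i) e)
        rw [mul_pow, ← sq_abs (sgn _), abs_sgn, one_pow, one_mul] at h4
        linarith
    simp only [sum_sub_distrib _ (fun _ => Real.log 2), sum_const, nsmul_eq_mul, card_univ,
      Fintype.card_fin] at h2
    rw [sum_sub_distrib, sum_const, nsmul_eq_mul, card_univ, Fintype.card_fin] at h2
    linarith
  have h := hG.trans (sum_le_sum fun e _ => hlog e)
  -- By the tower property the linear term averages to bias^2 / 4, which leaves a net gain of 1/4 -
  -- 1/8 = 1/8.
  have hcond : ∑ e ∈ E, ∑ i, ∑ j, (sgn (e.1 i j) * bias E i j (context i e) / 4 -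
        bias E i j (context i e) ^ 2 / 8) =
      (∑ e ∈ E, ∑ i, ∑ j, bias E i j (context i e) ^ 2) / 8 := by
    have h1 : ∀ f : (Fin k → Fin m → Bool) × (Fin k → Fin m × Bool) → Fin k → Fin m → ℝ,
        ∑ e ∈ E, ∑ i, ∑ j, f e i j = ∑ i, ∑ j, ∑ e ∈ E, f e i j := fun f => by
      rw [sum_comm]; exact sum_congr rfl fun i _ => sum_comm
    rw [h1, h1, sum_div]
    refine sum_congr rfl fun i _ => ?_
    rw [sum_div]
    refine sum_congr rfl fun j _ => ?_
    rw [sum_sub_distrib, ← sum_div, ← sum_div, sum_sgn_mul_eq E i j (fun c => bias E i j c)]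
    simp only [← sq]
    ring
  rw [sum_sub_distrib, hcond, sum_const, nsmul_eq_mul] at h
  linarith

/-- Convexity: `exp` lies below its chord between 0 and L. -/
theorem exp_mul_le_one_add {c L : ℝ} (h0 : 0 ≤ c) (h1 : c ≤ 1) :
    Real.exp (L * c) ≤ 1 + c * Real.exp L := by
  have h := convexOn_exp.2 (Set.mem_univ (0 : ℝ)) (Set.mem_univ L) (sub_nonneg.2 h1) h0
    (sub_add_cancel 1 c)
  simp only [smul_eq_mul, mul_zero, zero_add, Real.exp_zero, mul_one] at h
  rw [mul_comm L c]
  linarith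

/-- The bits that Bob's input points to are biased only if many bits are, or if the set of pairs is
small. -/
theorem mul_sum_sq_bias_selected_le (hE : ∀ e ∈ E, hits e.1 e.2 = noHit) (L : ℝ) :
    L * ∑ e ∈ E, ∑ i, bias E i (e.2 i).1 (context i e) ^ 2 ≤
      #E * (k * (m * Real.log 2) + k * Real.log m - Real.log #E) +
        Real.exp L / m * ∑ e ∈ E, ∑ i, ∑ j, bias E i j (context i e) ^ 2 := by
  have hm : (0 : ℝ) < m := by exact_mod_cast NeZero.pos m
  let v (i : Fin k) (j : Fin m) (e : (Fin k → Fin m → Bool) × (Fin k → Fin m × Bool)) : ℝ :=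
    Real.exp (L * bias E i j (context i e) ^ 2)
  let Z (i : Fin k) (e : (Fin k → Fin m → Bool) × (Fin k → Fin m × Bool)) : ℝ := ∑ j, v i j e
  have hv : ∀ i j e, 0 < v i j e := fun i j e => Real.exp_pos _
  have hZ : ∀ i e, 0 < Z i e := fun i e => sum_pos (fun j _ => hv i j e) ⟨0, mem_univ _⟩
  -- Given all of Alice's input, absence of a hit fixes Bob's bit, so only his position is coded,
  -- with weight proportional to exp (L bias^2).
  let r (i : Fin k) (y : Fin m × Bool)
      (e : (Fin k → Fin m → Bool) × (Fin k → Fin m × Bool)) : ℝ :=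
    if e.1 i y.1 = y.2 then 0 else v i y.1 e / Z i e
  have hr : ∀ i y e, 0 ≤ r i y e := fun i y e => by
    simp only [r]; split_ifs
    exacts [le_rfl, (div_pos (hv _ _ _) (hZ _ _)).le]
  have hrE : ∀ e ∈ E, ∀ i, r i (e.2 i) e = v i (e.2 i).1 e / Z i e := fun e he i => by
    have := congrFun (hE e he) i
    simp only [hits, noHit, beq_eq_false_iff_ne] at this
    simp only [r, if_neg this]
  let Q (e : (Fin k → Fin m → Bool) × (Fin k → Fin m × Bool)) : ℝ :=
    (((2 : ℝ) ^ m)⁻¹) ^ k * ∏ i, r i (e.2 i) e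
  have hQ : ∀ e ∈ E, 0 < Q e := fun e he => mul_pos (by positivity)
    (prod_pos fun i _ => by rw [hrE e he]; exact div_pos (hv _ _ _) (hZ _ _))
  have hsum : ∑ e ∈ E, Q e ≤ 1 := by
    refine (sum_le_univ_sum_of_nonneg fun e =>
      mul_nonneg (by positivity) (prod_nonneg fun i _ => hr _ _ _)).trans_eq ?_
    rw [Fintype.sum_prod_type]
    have h1 : ∀ X : Fin k → Fin m → Bool, ∑ Y : Fin k → Fin m × Bool, Q (X, Y) =
        (((2 : ℝ) ^ m)⁻¹) ^ k := fun X => by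
      simp only [Q]
      rw [← mul_sum, sum_prod_sequential_rev k (fun i y Y => r i y (X, Y)), mul_one]
      · intro i y Y Y' h
        simp only [r, Z, v]
        rw [(context_eq_iff i (X, Y) (X, Y')).2 ⟨fun _ _ => rfl, h⟩]
      · intro i Y
        rw [Fintype.sum_prod_type]
        have : ∀ j, ∑ b, r i (j, b) (X, Y) = v i j (X, Y) / Z i (X, Y) := fun j => by
          simp only [Fintype.sum_bool, r]
          cases X i j <;> simp
        rw [sum_congr rfl fun j _ => this j, ← sum_div, div_self (hZ _ _).ne']
    rw [sum_congr rfl fun X _ => h1 X]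
    simp only [sum_const, nsmul_eq_mul, card_univ, Fintype.card_pi,
      Fintype.card_fin, Fintype.card_bool, prod_const]
    push_cast
    rw [← mul_pow, mul_inv_cancel₀ (by positivity), one_pow]
  have hG := card_mul_log_card_le E Q hQ hsum
  have hlog : ∀ e ∈ E, -Real.log (Q e) ≤ k * (m * Real.log 2) + k * Real.log m +
      Real.exp L / m * ∑ i, ∑ j, bias E i j (context i e) ^ 2 -
      L * ∑ i, bias E i (e.2 i).1 (context i e) ^ 2 := fun e he => by
    have h1 : Real.log (Q e) = -(k * (m * Real.log 2)) +
        ∑ i, (L * bias E i (e.2 i).1 (context i e) ^ 2 - Real.log (Z i e)) := by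
      simp only [Q]
      rw [Real.log_mul (by positivity) (prod_ne_zero_iff.2 fun i _ => by
        rw [hrE e he]; exact (div_pos (hv _ _ _) (hZ _ _)).ne'), Real.log_pow, Real.log_inv,
        Real.log_pow, mul_neg, Real.log_prod fun i _ => by
        rw [hrE e he]; exact (div_pos (hv _ _ _) (hZ _ _)).ne']
      congr 1
      refine sum_congr rfl fun i _ => ?_
      rw [hrE e he, Real.log_div (hv _ _ _).ne' (hZ _ _).ne']
      simp only [v, Real.log_exp]
    -- The price of the tilt: the normaliser exceeds m by at most exp L times the total squared bias
    -- of the block.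
    have h2 : ∀ i, Real.log (Z i e) ≤
        Real.log m + Real.exp L / m * ∑ j, bias E i j (context i e) ^ 2 := fun i => by
      have h3 : Z i e ≤ m * (1 + Real.exp L / m * ∑ j, bias E i j (context i e) ^ 2) := by
        have : Z i e ≤ ∑ j, (1 + bias E i j (context i e) ^ 2 * Real.exp L) :=
          sum_le_sum fun j _ => exp_mul_le_one_add (sq_nonneg _)
            ((sq_le_one_iff_abs_le_one _).2 (abs_bias_le _ _ _ _))
        rw [sum_add_distrib, ← sum_mul] at this
        simp only [sum_const, nsmul_eq_mul, card_univ, Fintype.card_fin, mul_one] at this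
        refine this.trans_eq ?_
        field_simp
      have h4 : 0 ≤ Real.exp L / m * ∑ j, bias E i j (context i e) ^ 2 :=
        mul_nonneg (by positivity) (sum_nonneg fun _ _ => sq_nonneg _)
      refine (Real.log_le_log (hZ i e) h3).trans ?_
      rw [Real.log_mul hm.ne' (by linarith)]
      have := Real.log_le_sub_one_of_pos
        (x := 1 + Real.exp L / m * ∑ j, bias E i j (context i e) ^ 2) (by linarith)
      linarith
    have h5 := sum_le_sum fun i (_ : i ∈ (univ : Finset (Fin k))) => h2 i
    rw [sum_add_distrib, ← mul_sum] at h5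
    simp only [sum_const, nsmul_eq_mul, card_univ, Fintype.card_fin] at h5
    rw [h1, sum_sub_distrib, ← mul_sum]
    linarith
  have h := hG.trans (sum_le_sum hlog)
  rw [sum_sub_distrib, sum_add_distrib, sum_const, nsmul_eq_mul, ← mul_sum, ← mul_sum] at h
  linarith

end ConvexSetDisjointness

/-! ### The corruption bound. -/

namespace ConvexSetDisjointness

open Finset

variable {k m : ℕ} [NeZero m]

/-- Once the context is fixed, hits before i depend on Bob's input alone and hits after i on Alice's
alone. Requiring none outside block i thus leaves a rectangle, to which
`card_related_sub_le_card_unrelated` applies with "no hit in block i" as the relation. -/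
theorem card_fiber_sub_le (A : Finset (Fin k → Fin m → Bool)) (B : Finset (Fin k → Fin m × Bool))
    (i : Fin k) (c : (Fin k → Fin m → Bool) × (Fin k → Fin m × Bool)) :
    (#{e ∈ cell A B noHit | context i e = c} : ℝ) -
        4 * ∑ e ∈ cell A B noHit with context i e = c,
          |bias (cell A B noHit) i (e.2 i).1 (context i e)| ≤
      #{e ∈ cell A B (hitAt i) | context i e = c} := by
  rcases ({e ∈ cell A B noHit | context i e = c}).eq_empty_or_nonempty with h0 | ⟨e₀, he₀⟩
  · rw [h0]; simp
  obtain ⟨he₀, rfl⟩ := mem_filter.1 he₀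
  set E := cell A B noHit with hE
  let S : Finset (Fin k → Fin m → Bool) :=
    {X ∈ A | ∀ l, (l < i → X l = e₀.1 l) ∧ (i < l → hits X e₀.2 l = false)}
  let T : Finset (Fin k → Fin m × Bool) :=
    {Y ∈ B | ∀ l, (i < l → Y l = e₀.2 l) ∧ (l < i → hits e₀.1 Y l = false)}
  have key : ∀ e : (Fin k → Fin m → Bool) × (Fin k → Fin m × Bool), e ∈ S ×ˢ T ↔
      e ∈ A ×ˢ B ∧ context i e = context i e₀ ∧ ∀ l, l ≠ i → hits e.1 e.2 l = false := by
    rintro ⟨X, Y⟩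
    simp only [S, T, mem_product, mem_filter, context_eq_iff]
    constructor
    · rintro ⟨⟨hX, hX'⟩, hY, hY'⟩
      refine ⟨⟨hX, hY⟩, ⟨fun l hl => (hX' l).1 hl, fun l hl => (hY' l).1 hl⟩, fun l hl => ?_⟩
      rcases lt_or_gt_of_ne hl with h | h
      · have := (hY' l).2 h
        simpa only [hits, (hX' l).1 h] using this
      · have := (hX' l).2 h
        simpa only [hits, (hY' l).1 h] using this
    · rintro ⟨⟨hX, hY⟩, ⟨h1, h2⟩, h3⟩
      refine ⟨⟨hX, fun l => ⟨h1 l, fun h => ?_⟩⟩, hY, fun l => ⟨h2 l, fun h => ?_⟩⟩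
      · simpa only [hits, h2 l h] using h3 l h.ne'
      · simpa only [hits, h1 l h] using h3 l h.ne
  have hzero : {e ∈ E | context i e = context i e₀} =
      {e ∈ S ×ˢ T | hits e.1 e.2 i = false} := by
    ext e
    rw [mem_filter, mem_filter, key, hE, cell, mem_filter]
    constructor
    · rintro ⟨⟨h1, h2⟩, h3⟩
      exact ⟨⟨h1, h3, fun l _ => congrFun h2 l⟩, congrFun h2 i⟩
    · rintro ⟨⟨h1, h2, h3⟩, h4⟩
      refine ⟨⟨h1, funext fun l => ?_⟩, h2⟩
      by_cases hl : l = i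
      · rw [hl, h4]; rfl
      · exact h3 l hl
  have hone : {e ∈ cell A B (hitAt i) | context i e = context i e₀} =
      {e ∈ S ×ˢ T | ¬ hits e.1 e.2 i = false} := by
    ext e
    rw [mem_filter, mem_filter, key, cell, mem_filter]
    constructor
    · rintro ⟨⟨h1, h2⟩, h3⟩
      exact ⟨⟨h1, h3, fun l hl => by simp [h2, hitAt, hl]⟩, by simp [h2, hitAt]⟩
    · rintro ⟨⟨h1, h2, h3⟩, h4⟩
      refine ⟨⟨h1, funext fun l => ?_⟩, h2⟩
      by_cases hl : l = i
      · subst hl; simpa [hitAt] using h4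
      · simpa [hitAt, hl] using h3 l hl
  let β (j : Fin m) : ℝ := bias E i j (context i e₀)
  -- The fraction of no-hit pairs whose Alice input hits `Y` in block i is determined by the bias of
  -- the bit that `Y` selects.
  have hβ : ∀ Y : Fin k → Fin m × Bool, (1 + sgn (Y i).2 * β (Y i).1) / 2 *
      #{e ∈ S ×ˢ T | hits e.1 e.2 i = false} =
      #{e ∈ S ×ˢ T | hits e.1 e.2 i = false ∧ ¬ hits e.1 Y i = false} := fun Y => by
    have h1 := bias_mul_card E i (Y i).1 (context i e₀)
    rw [hzero] at h1
    rw [← filter_filter]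
    conv_rhs => rw [card_filter, Nat.cast_sum]
    have h2 : ∀ e : (Fin k → Fin m → Bool) × (Fin k → Fin m × Bool),
        (((if ¬ hits e.1 Y i = false then 1 else 0 : ℕ)) : ℝ) =
        (1 + sgn (Y i).2 * sgn (e.1 i (Y i).1)) / 2 := fun e => by
      simp only [hits, sgn]
      rcases Bool.eq_false_or_eq_true (e.1 i (Y i).1) with h | h <;>
        rcases Bool.eq_false_or_eq_true (Y i).2 with h' | h' <;> simp [h, h']
    rw [sum_congr rfl fun e _ => h2 e, ← sum_div, sum_add_distrib, ← mul_sum, ← h1, sum_const,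
      nsmul_eq_mul]
    simp only [β]
    ring
  have h := card_related_sub_le_card_unrelated S T (fun X Y => hits X Y i = false)
    (fun Y => (1 + sgn (Y i).2 * β (Y i).1) / 2) (fun Y _ => hβ Y)
  rw [hone, hzero]
  refine le_trans (sub_le_sub_left ?_ _) h
  have h3 : ∑ e ∈ S ×ˢ T with hits e.1 e.2 i = false,
        max (1 / 2 - (1 + sgn (e.2 i).2 * β (e.2 i).1) / 2) 0 ≤
      ∑ e ∈ S ×ˢ T with hits e.1 e.2 i = false, |bias E i (e.2 i).1 (context i e)| / 2 := by
    refine sum_le_sum fun e he => ?_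
    rw [← hzero] at he
    rw [(mem_filter.1 he).2]
    refine max_le ?_ (by positivity)
    have := neg_abs_le (sgn (e.2 i).2 * β (e.2 i).1)
    rw [abs_mul, abs_sgn, one_mul] at this
    simp only [β] at this ⊢
    linarith
  rw [← sum_div] at h3
  linarith

theorem card_sub_le_card_hitAt (A : Finset (Fin k → Fin m → Bool))
    (B : Finset (Fin k → Fin m × Bool)) (i : Fin k) :
    (#(cell A B noHit) : ℝ) - 4 * ∑ e ∈ cell A B noHit,
          |bias (cell A B noHit) i (e.2 i).1 (context i e)| ≤ #(cell A B (hitAt i)) := by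
  have h := sum_le_sum fun c (_ : c ∈ univ) => card_fiber_sub_le A B i c
  rw [sum_sub_distrib, ← mul_sum, sum_fiberwise, ← Nat.cast_sum, ← Nat.cast_sum,
    ← card_eq_sum_card_fiberwise fun _ _ => mem_univ _,
    ← card_eq_sum_card_fiberwise fun _ _ => mem_univ _] at h
  exact h

/-- The corruption bound: a large rectangle contains nearly as many pairs with a unique hit, on
average over its position, as pairs without a hit. -/
theorem corruption {k : ℕ} (hlogm : 5000 ≤ Real.log m)
    (A : Finset (Fin k → Fin m → Bool)) (B : Finset (Fin k → Fin m × Bool))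
    (hlarge : ((2 ^ m * m : ℝ) ^ k) * Real.exp (-(k * Real.log m / 1000)) ≤ #(cell A B noHit)) :
    3 / 5 * k * (#(cell A B noHit) : ℝ) ≤ ∑ i, (#(cell A B (hitAt i)) : ℝ) := by
  set E := cell A B noHit with hE
  have hmpos : (0 : ℝ) < m := by exact_mod_cast NeZero.pos m
  have hEpos : (0 : ℝ) < #E := lt_of_lt_of_le (by positivity) hlarge
  have hlog2' : Real.log 2 ≤ 1 := by linarith [Real.log_two_lt_d9]
  have hlogE : k * (m * Real.log 2) + k * Real.log m - Real.log #E ≤ k * Real.log m / 1000 := by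
    have h := Real.log_le_log (by positivity) hlarge
    rw [Real.log_mul (by positivity) (by positivity), Real.log_exp, Real.log_pow,
      Real.log_mul (by positivity) (by positivity), Real.log_pow] at h
    linarith
  set L := Real.log m / 2 with hL
  have hexp : Real.exp L / m ≤ 1 / 2500 := by
    -- With this L the tilt costs exp L / m = m^(-1/2), while its gain is still of order log m.
    have h1 : Real.exp L * Real.exp L = m := by
      rw [← Real.exp_add, hL, add_halves, Real.exp_log hmpos]
    have h2 : (2500 : ℝ) ≤ Real.exp L := by
      have := Real.add_one_le_exp L
      linarith
    rw [div_le_div_iff₀ hmpos (by norm_num), ← h1]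
    nlinarith
  set S1 := ∑ e ∈ E, ∑ i, ∑ j, bias E i j (context i e) ^ 2 with hS1
  set S2 := ∑ e ∈ E, ∑ i, bias E i (e.2 i).1 (context i e) ^ 2 with hS2
  have h1 : S1 ≤ 8 * (#E * (k + k * Real.log m / 1000)) := by
    refine (sum_sq_bias_le E).trans ?_
    refine mul_le_mul_of_nonneg_left (mul_le_mul_of_nonneg_left ?_ hEpos.le) (by norm_num)
    rw [Real.log_mul two_ne_zero hmpos.ne']
    have : (k : ℝ) * Real.log 2 ≤ k := mul_le_of_le_one_right (Nat.cast_nonneg _) hlog2'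
    linarith
  have h2 : L * S2 ≤ #E * (k * Real.log m / 1000) + 1 / 2500 * S1 := by
    refine (mul_sum_sq_bias_selected_le E (fun e he => (mem_filter.1 he).2) L).trans ?_
    refine add_le_add (mul_le_mul_of_nonneg_left hlogE hEpos.le) (mul_le_mul_of_nonneg_right hexp ?_)
    exact sum_nonneg fun _ _ => sum_nonneg fun _ _ => sum_nonneg fun _ _ => sq_nonneg _
  have h3 : S2 ≤ #E * k / 200 := by
    have hk : (0 : ℝ) ≤ #E * k := by positivity
    refine le_of_mul_le_mul_left ?_ (by linarith : 0 < L)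
    nlinarith
  -- With S2 ≤ #E k / 200 the total is at most 3/40 of #E k. Four times this is below 2/5, as the
  -- ratio 3/5 requires.
  have h4 : ∑ i, ∑ e ∈ E, |bias E i (e.2 i).1 (context i e)| ≤ #E * k / 20 + 5 * S2 := by
    have h5 : ∀ i, ∀ e ∈ E, |bias E i (e.2 i).1 (context i e)| ≤
        1 / 20 + 5 * bias E i (e.2 i).1 (context i e) ^ 2 := fun i e _ => by
      rw [← sq_abs]
      nlinarith [sq_nonneg (|bias E i (e.2 i).1 (context i e)| - 1 / 10)]
    refine (sum_le_sum fun i _ => sum_le_sum (h5 i)).trans_eq ?_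
    rw [sum_comm, hS2]
    simp only [sum_add_distrib, ← mul_sum, sum_const, nsmul_eq_mul, card_univ, Fintype.card_fin]
    ring
  have h6 := sum_le_sum fun i (_ : i ∈ univ) => card_sub_le_card_hitAt A B i
  rw [sum_sub_distrib, ← mul_sum, sum_const, nsmul_eq_mul, card_univ, Fintype.card_fin, ← hE] at h6
  have hk : (0 : ℝ) ≤ #E * k := by positivity
  linarith

end ConvexSetDisjointness

/-! ### From corruption to randomized protocols. -/

namespace ConvexSetDisjointness

open Finset

/-- The leaves partition the inputs into at most 2^cost rectangles. An accepting rectangle either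
has at least `θ` no-hit pairs, so that corruption applies, or is paid for by one `θ`. -/
theorem Protocol.card_accepted_le {k m : ℕ} {α β : Type}
    (f : (Fin k → Fin m → Bool) → α) (g : (Fin k → Fin m × Bool) → β) {θ : ℝ} (hθ : 0 ≤ θ)
    (hcor : ∀ A B, θ ≤ #(cell (k := k) (m := m) A B noHit) →
      3 / 5 * k * (#(cell A B noHit) : ℝ) ≤ ∑ i, (#(cell A B (hitAt i)) : ℝ))
    (P : Protocol α β) (A : Finset (Fin k → Fin m → Bool)) (B : Finset (Fin k → Fin m × Bool)) :
    3 / 5 * k * ((#{e ∈ cell A B noHit | P.eval (f e.1) (g e.2) = true} : ℝ) - 2 ^ P.cost * θ) ≤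
      ∑ i, (#{e ∈ cell A B (hitAt i) | P.eval (f e.1) (g e.2) = true} : ℝ) := by
  have split : ∀ (a b : ℕ), 2 ^ a * θ + 2 ^ b * θ ≤ 2 ^ (max a b + 1) * θ := fun a b => by
    rw [← add_mul, pow_succ]
    refine mul_le_mul_of_nonneg_right ?_ hθ
    have h1 : (2 : ℝ) ^ a ≤ 2 ^ max a b := pow_le_pow_right₀ one_le_two (le_max_left _ _)
    have h2 : (2 : ℝ) ^ b ≤ 2 ^ max a b := pow_le_pow_right₀ one_le_two (le_max_right _ _)
    linarith
  have hk : (0 : ℝ) ≤ 3 / 5 * k := by positivity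
  induction P generalizing A B with
  | leaf out =>
    cases out with
    | false =>
      simp only [Protocol.eval, Bool.false_eq_true, filter_false, card_empty, Nat.cast_zero,
        sum_const_zero, zero_sub]
      exact mul_nonpos_of_nonneg_of_nonpos hk (neg_nonpos.2 (by positivity))
    | true =>
      simp only [Protocol.eval, filter_true, Protocol.cost, pow_zero, one_mul]
      rcases le_total θ #(cell A B noHit) with h | h
      · refine le_trans (mul_le_mul_of_nonneg_left ?_ hk) (hcor A B h)
        linarith
      · exact (mul_nonpos_of_nonneg_of_nonpos hk (sub_nonpos.2 h)).trans
          (sum_nonneg fun _ _ => Nat.cast_nonneg _)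
  | alice bit next ih =>
    have h : ∀ s, (#{e ∈ cell A B s | (Protocol.alice bit next).eval (f e.1) (g e.2) = true} : ℝ) =
        #{e ∈ cell {X ∈ A | bit (f X) = false} B s | (next false).eval (f e.1) (g e.2) = true} +
        #{e ∈ cell {X ∈ A | bit (f X) = true} B s | (next true).eval (f e.1) (g e.2) = true} :=
      fun s => by
        rw [← card_filter_add_card_filter_not (fun e => bit (f e.1) = false), Nat.cast_add]
        congr 3 <;> ext e <;> simp only [cell, mem_filter, mem_product] <;>
          rw [Protocol.eval] <;> cases bit (f e.1) <;> simp
    simp only [h, sum_add_distrib, Protocol.cost]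
    have h0 := ih false {X ∈ A | bit (f X) = false} B
    have h1 := ih true {X ∈ A | bit (f X) = true} B
    have h2 := mul_le_mul_of_nonneg_left (split (next false).cost (next true).cost) hk
    linarith
  | bob bit next ih =>
    have h : ∀ s, (#{e ∈ cell A B s | (Protocol.bob bit next).eval (f e.1) (g e.2) = true} : ℝ) =
        #{e ∈ cell A {Y ∈ B | bit (g Y) = false} s | (next false).eval (f e.1) (g e.2) = true} +
        #{e ∈ cell A {Y ∈ B | bit (g Y) = true} s | (next true).eval (f e.1) (g e.2) = true} :=
      fun s => by
        rw [← card_filter_add_card_filter_not (fun e => bit (g e.2) = false), Nat.cast_add]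
        congr 3 <;> ext e <;> simp only [cell, mem_filter, mem_product] <;>
          rw [Protocol.eval] <;> cases bit (g e.2) <;> simp
    simp only [h, sum_add_distrib, Protocol.cost]
    have h0 := ih false A {Y ∈ B | bit (g Y) = false}
    have h1 := ih true A {Y ∈ B | bit (g Y) = true}
    have h2 := mul_le_mul_of_nonneg_left (split (next false).cost (next true).cost) hk
    linarith

/-- If every outcome incurs total weight at least `v` from events of probability at most `1/3`, then
`v` is at most a third of the total weight. -/
theorem le_sum_div_three {Ω ι : Type*} (μ : PMF Ω) (I : Finset ι) (S : ι → Set Ω) (w : ι → ℝ)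
    (hw : ∀ i ∈ I, 0 ≤ w i) (hS : ∀ i ∈ I, μ.toOuterMeasure (S i) ≤ 1 / 3) (v : ℝ)
    (hv : ∀ ω, v ≤ ∑ i ∈ I, (S i).indicator (fun _ => w i) ω) : v ≤ (∑ i ∈ I, w i) / 3 := by
  have h0 : 0 ≤ (∑ i ∈ I, w i) / 3 := div_nonneg (sum_nonneg hw) (by norm_num)
  rw [← ENNReal.ofReal_le_ofReal_iff h0]
  calc ENNReal.ofReal v = ∑' ω, μ ω * ENNReal.ofReal v := by
        rw [ENNReal.tsum_mul_right, μ.tsum_coe, one_mul]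
    _ ≤ ∑' ω, ∑ i ∈ I, (S i).indicator μ ω * ENNReal.ofReal (w i) := by
        refine ENNReal.tsum_le_tsum fun ω => ?_
        refine (mul_le_mul_right (ENNReal.ofReal_le_ofReal (hv ω)) _).trans ?_
        rw [ENNReal.ofReal_sum_of_nonneg fun i hi => Set.indicator_nonneg (fun _ _ => hw i hi) _,
          mul_sum]
        refine sum_le_sum fun i _ => ?_
        by_cases h : ω ∈ S i <;> simp [h]
    _ = ∑ i ∈ I, μ.toOuterMeasure (S i) * ENNReal.ofReal (w i) := by
        rw [Summable.tsum_finsetSum fun _ _ => ENNReal.summable]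
        refine sum_congr rfl fun i _ => ?_
        rw [ENNReal.tsum_mul_right, PMF.toOuterMeasure_apply]
    _ ≤ ∑ i ∈ I, 1 / 3 * ENNReal.ofReal (w i) :=
        sum_le_sum fun i hi => mul_le_mul_left (hS i hi) _
    _ = ENNReal.ofReal ((∑ i ∈ I, w i) / 3) := by
        rw [← mul_sum, ← ENNReal.ofReal_sum_of_nonneg hw, div_eq_inv_mul,
          ENNReal.ofReal_mul (by norm_num), ENNReal.ofReal_inv_of_pos (by norm_num), one_div]
        norm_num

/-- Randomized lower bound for any partial function that contains the lopsided disjointness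
problem. -/
theorem log_le_cost {k m : ℕ} [NeZero m] (hk : 1 ≤ k) (hlogm : 5000 ≤ Real.log m) {α β Ω : Type}
    (F : α → β → Option Bool) (f : (Fin k → Fin m → Bool) → α) (g : (Fin k → Fin m × Bool) → β)
    (hF1 : ∀ X Y, hits X Y = noHit → F (f X) (g Y) = some true)
    (hF0 : ∀ X Y i, hits X Y = hitAt i → F (f X) (g Y) = some false)
    (μ : PMF Ω) (P : Ω → Protocol α β) (hcomp : ComputesWithError μ P F (1 / 3)) (c : ℕ)
    (hcost : ∀ ω, (P ω).cost ≤ c) : k * Real.log m / 5000 ≤ c := by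
  have hmpos : (0 : ℝ) < m := by exact_mod_cast NeZero.pos m
  have hkpos : (0 : ℝ) < k := by exact_mod_cast hk
  set N : ℝ := (2 ^ m * m : ℝ) ^ k with hN
  have hNpos : 0 < N := by positivity
  have hcard : ∀ s, (#(cell (k := k) (m := m) univ univ s) : ℝ) = N := fun s => by
    rw [card_cell_univ]; push_cast; rfl
  set θ : ℝ := N * Real.exp (-(k * Real.log m / 1000)) with hθ
  have hθ0 : 0 < θ := by positivity
  let I : Finset (Σ _ : Option (Fin k), (Fin k → Fin m → Bool) × (Fin k → Fin m × Bool)) :=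
    univ.sigma fun o => cell univ univ (o.elim noHit hitAt)
  -- Weight 3k/5 on no-hit pairs matches the corruption ratio: each accepted no-hit pair is offset
  -- by accepted one-hit pairs, up to the `θ` terms. The total weight is 8kN/5.
  have hmain := le_sum_div_three μ I
    (fun p => {ω | (P ω).eval (f p.2.1) (g p.2.2) ≠ p.1.elim true fun _ => false})
    (fun p => p.1.elim (3 / 5 * k) fun _ => 1) ?_ ?_ (3 / 5 * k * (N - 2 ^ c * θ)) ?_
  · simp only [I, sum_sigma, Fintype.sum_option, Option.elim_none, Option.elim_some, sum_const,
      nsmul_eq_mul, hcard, mul_one, card_univ, Fintype.card_fin] at hmain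
    -- 3/5 exceeds a third of 8/5 by 1/15, and 9 = (3/5) / (1/15). Error 1/3 needs no amplification
    -- because 3/5 > 1/2.
    have h1 : N ≤ 9 * (2 ^ c * θ) := by
      have : k * N ≤ k * (9 * (2 ^ c * θ)) := by linarith
      exact le_of_mul_le_mul_left this hkpos
    have h2 : 1 ≤ 9 * 2 ^ c * Real.exp (-(k * Real.log m / 1000)) := by
      refine le_of_mul_le_mul_left ?_ hNpos
      rw [mul_one]
      refine h1.trans_eq ?_
      rw [hθ]; ring
    have h3 := Real.log_le_log one_pos h2
    rw [Real.log_one, Real.log_mul (by positivity) (Real.exp_ne_zero _), Real.log_exp,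
      Real.log_mul (by norm_num) (by positivity), Real.log_pow] at h3
    have h4 : Real.log 9 ≤ 4 := by
      have : Real.log 9 ≤ Real.log (2 ^ 4) := Real.log_le_log (by norm_num) (by norm_num)
      rw [Real.log_pow] at this
      push_cast at this
      linarith [Real.log_two_lt_d9]
    have h5 : (c : ℝ) * Real.log 2 ≤ c :=
      mul_le_of_le_one_right (Nat.cast_nonneg _) (by linarith [Real.log_two_lt_d9])
    -- This absorbs log 9 ≤ 4: passing from 1/1000 to 1/5000 frees (4/5000) k log m ≥ 4.
    have h6 : (5000 : ℝ) ≤ k * Real.log m := by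
      have : (1 : ℝ) ≤ k := by exact_mod_cast hk
      nlinarith
    linarith
  · rintro ⟨_ | i, e⟩ _
    · simp only [Option.elim_none]; positivity
    · simp
  · rintro ⟨_ | i, e⟩ he
    · exact hcomp _ _ true (hF1 _ _ (mem_filter.1 (mem_sigma.1 he).2).2)
    · exact hcomp _ _ false (hF0 _ _ i (mem_filter.1 (mem_sigma.1 he).2).2)
  · intro ω
    have h := (P ω).card_accepted_le f g hθ0.le (fun A B h => corruption hlogm A B h) univ univ
    have hcle : (2 : ℝ) ^ (P ω).cost * θ ≤ 2 ^ c * θ :=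
      mul_le_mul_of_nonneg_right (pow_le_pow_right₀ one_le_two (hcost ω)) hθ0.le
    have hsplit := card_filter_add_card_filter_not (s := cell (k := k) (m := m) univ univ noHit)
      (fun e => (P ω).eval (f e.1) (g e.2) = true)
    have hsplit' := congrArg (Nat.cast (R := ℝ)) hsplit
    rw [hcard, Nat.cast_add] at hsplit'
    have hmul := mul_le_mul_of_nonneg_left hcle (by positivity : (0 : ℝ) ≤ 3 / 5 * k)
    simp only [I, sum_sigma, Fintype.sum_option, Option.elim_none, Option.elim_some]
    simp only [Set.indicator_apply, Set.mem_ofPred_eq, ← sum_filter, sum_const, nsmul_eq_mul,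
      mul_one, ne_eq, Bool.not_eq_false]
    rw [← eq_sub_iff_add_eq'] at hsplit'
    rw [hsplit']
    linarith

end ConvexSetDisjointness

/-! ### The moment curve and the choice of parameters. -/

namespace ConvexSetDisjointness

open Finset

/-- The moment curve in `ℝ^d`. -/
def momentCurve (d : ℕ) (t : ℝ) : Fin d → ℝ := fun i => t ^ (i.1 + 1)

theorem momentCurve_injective {d : ℕ} (hd : 0 < d) : Function.Injective (momentCurve d) :=
  fun s t h => by simpa [momentCurve] using congrFun h ⟨0, hd⟩

/-- A polynomial of degree at most `d` is an affine function of the point on the moment curve. -/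
theorem eval_eq_momentCurve {d : ℕ} (p : Polynomial ℝ) (hp : p.natDegree ≤ d) (t : ℝ) :
    p.eval t = p.coeff 0 + ∑ i : Fin d, p.coeff (i.1 + 1) * momentCurve d t i := by
  rw [Polynomial.eval_eq_sum_range' (Nat.lt_succ_of_le hp), sum_range_succ', sum_range]
  simp [momentCurve, add_comm]

/-- Few points of the moment curve span a face of the convex hull of any set of its points. -/
theorem disjoint_convexHull_momentCurve {d : ℕ} (X : Set ℝ) (Y : Finset ℝ) (hY : 2 * #Y ≤ d)
    (h : ∀ y ∈ Y, y ∉ X) :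
    Disjoint (convexHull ℝ (momentCurve d '' X)) (convexHull ℝ (momentCurve d '' Y)) := by
  let p : Polynomial ℝ := ∏ y ∈ Y, (Polynomial.X - Polynomial.C y) ^ 2
  have hp : p.natDegree ≤ d := by
    refine le_trans ?_ hY
    refine (Polynomial.natDegree_prod_le _ _).trans ?_
    refine (sum_le_sum fun y _ => Polynomial.natDegree_pow_le).trans ?_
    simp [mul_comm]
  have hev : ∀ t, p.eval t = ∏ y ∈ Y, (t - y) ^ 2 := fun t => by
    simp [p, Polynomial.eval_prod]
  -- The linear part of `p` along the curve; the hyperplane φ = -p(0) contains Bob's points and has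
  -- Alice's strictly on one side.
  let φ : (Fin d → ℝ) →ₗ[ℝ] ℝ := ∑ i : Fin d, p.coeff (i.1 + 1) • LinearMap.proj i
  have hφ : ∀ t, φ (momentCurve d t) = p.eval t - p.coeff 0 := fun t => by
    rw [eval_eq_momentCurve p hp]
    simp [φ]
  refine Set.disjoint_of_subset (convexHull_min (t := {z | -p.coeff 0 < φ z}) ?_ ?_)
    (convexHull_min (t := {z | φ z ≤ -p.coeff 0}) ?_ ?_) ?_
  · rintro _ ⟨t, ht, rfl⟩
    have : 0 < p.eval t := by
      rw [hev]
      refine prod_pos fun y hy => ?_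
      have : t - y ≠ 0 := fun h0 => h y hy (by rwa [← sub_eq_zero.1 h0])
      positivity
    simp only [Set.mem_ofPred_eq, hφ]
    linarith
  · exact convex_halfSpace_gt φ.isLinear _
  · rintro _ ⟨t, ht, rfl⟩
    have : p.eval t = 0 := by
      rw [hev]
      exact prod_eq_zero (mem_coe.1 ht) (by simp)
    simp only [Set.mem_ofPred_eq, hφ]
    linarith
  · exact convex_halfSpace_le φ.isLinear _
  · rw [Set.disjoint_left]
    intro z hz hz'
    simp only [Set.mem_ofPred_eq] at hz hz'
    exact absurd hz (not_lt.2 hz')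

/-- `n` points on the moment curve. -/
noncomputable def momentPoints (d n : ℕ) : Finset (Fin d → ℝ) :=
  (range n).image fun t : ℕ => momentCurve d t

theorem momentCurve_natCast_injective {d : ℕ} (hd : 0 < d) :
    Function.Injective fun t : ℕ => momentCurve d t :=
  (momentCurve_injective hd).comp Nat.cast_injective

theorem card_momentPoints {d : ℕ} (hd : 0 < d) (n : ℕ) : #(momentPoints d n) = n := by
  rw [momentPoints, card_image_of_injective _ (momentCurve_natCast_injective hd), card_range]

/-- The functions that both variants of convex set disjointness extend. -/
def SolvesConvexDisjointness {d : ℕ} {U : Finset (Fin d → ℝ)}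
    (F : Set U → Set U → Option Bool) : Prop :=
  (∀ X Y, (X ∩ Y).Nonempty → F X Y = some false) ∧
    ∀ X Y, hull X ∩ hull Y = ∅ → F X Y = some true

theorem hull_inter_nonempty {d : ℕ} {U : Finset (Fin d → ℝ)} {X Y : Set U}
    (h : (X ∩ Y).Nonempty) : (hull X ∩ hull Y).Nonempty := by
  obtain ⟨u, hX, hY⟩ := h
  exact ⟨u, subset_convexHull ℝ _ ⟨u, hX, rfl⟩, subset_convexHull ℝ _ ⟨u, hY, rfl⟩⟩

theorem solves_CSD {d : ℕ} (U : Finset (Fin d → ℝ)) : SolvesConvexDisjointness (CSD U) :=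
  ⟨fun _ _ h => if_pos (hull_inter_nonempty h), fun _ _ h => if_neg (by simp [h])⟩

theorem solves_PromiseCSD {d : ℕ} (U : Finset (Fin d → ℝ)) :
    SolvesConvexDisjointness (PromiseCSD U) :=
  ⟨fun _ _ h => if_pos h, fun _ _ h => by
    rw [PromiseCSD, if_neg, if_pos h]
    intro h'
    exact (hull_inter_nonempty h').ne_empty h⟩

theorem exists_protocol_of_randCC {α β : Type} [Finite α] (ε : ENNReal)
    (f : α → β → Option Bool) : ∃ (Ω : Type) (μ : PMF Ω) (P : Ω → Protocol α β),
      (∀ ω, (P ω).cost ≤ randCC ε f) ∧ ComputesWithError μ P f ε :=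
  Nat.sInf_mem (randCC_set_nonempty ε f)

/-- Without communication the output ignores the inputs, so it errs on either the pair of empty sets
or a pair of equal singletons. Two error probabilities of at most 1/3 cannot sum to 1. -/
theorem one_le_randCC {d : ℕ} {U : Finset (Fin d → ℝ)} (hU : U.Nonempty)
    {F : Set U → Set U → Option Bool} (hF : SolvesConvexDisjointness F) :
    1 ≤ randCC (1 / 3) F := by
  obtain ⟨u, hu⟩ := hU
  obtain ⟨Ω, μ, P, hc, hP⟩ := exists_protocol_of_randCC (1 / 3) F
  by_contra h
  have h0 : randCC (1 / 3) F = 0 := by omega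
  have hout : ∀ ω, ∃ b, P ω = .leaf b := fun ω => by
    have := hc ω
    rw [h0] at this
    cases hPω : P ω with
    | leaf b => exact ⟨b, rfl⟩
    | alice _ _ => simp [hPω, Protocol.cost] at this
    | bob _ _ => simp [hPω, Protocol.cost] at this
  have h1 := hP {⟨u, hu⟩} {⟨u, hu⟩} false (hF.1 _ _ (by simp))
  have h2 := hP ∅ ∅ true (hF.2 _ _ (by simp [hull]))
  have h3 := le_sum_div_three μ univ
    (fun b : Bool => if b then {ω | (P ω).eval ∅ ∅ ≠ true}
      else {ω | (P ω).eval {⟨u, hu⟩} {⟨u, hu⟩} ≠ false})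
    (fun _ => 1) (by simp) (by rintro (_ | _) _; exacts [h1, h2]) 1 (fun ω => by
      obtain ⟨b, hb⟩ := hout ω
      rw [Fintype.sum_bool]
      cases b <;> simp [hb, Protocol.eval])
  norm_num at h3

/-- Points of the moment curve embed lopsided disjointness into convex set disjointness. -/
theorem log_le_randCC {d n k m : ℕ} (hk : 1 ≤ k) (hkd : 2 * k ≤ d) (hn : 2 * m * k ≤ n)
    (hlogm : 5000 ≤ Real.log m)
    {F : Set (momentPoints d n) → Set (momentPoints d n) → Option Bool}
    (hF : SolvesConvexDisjointness F) : k * Real.log m / 5000 ≤ randCC (1 / 3) F := by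
  -- `Real.log 0 = 0`, so the lower bound on log m excludes m = 0.
  have hm : m ≠ 0 := by rintro rfl; norm_num at hlogm
  have : NeZero m := ⟨hm⟩
  have hd : 0 < d := by omega
  obtain ⟨Ω, μ, P, hc, hP⟩ := exists_protocol_of_randCC (1 / 3) F
  obtain ⟨ι⟩ : Nonempty (Fin k × Fin m × Bool ↪ Fin n) :=
    Function.Embedding.nonempty_of_card_le (by
      simp only [Fintype.card_prod, Fintype.card_fin, Fintype.card_bool]
      linarith)
  let pt (a : Fin k × Fin m × Bool) : momentPoints d n :=
    ⟨momentCurve d ((ι a : ℕ) : ℝ), mem_image_of_mem _ (mem_range.2 (ι a).2)⟩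
  have hpt : Function.Injective pt := fun a b h =>
    ι.injective (Fin.ext (momentCurve_natCast_injective hd (Subtype.ext_iff.1 h)))
  let f (X : Fin k → Fin m → Bool) : Set (momentPoints d n) :=
    pt '' {a | X a.1 a.2.1 = a.2.2}
  let g (Y : Fin k → Fin m × Bool) : Set (momentPoints d n) := Set.range fun l => pt (l, Y l)
  refine log_le_cost hk hlogm F f g (fun X Y h => hF.2 _ _ ?_)
    (fun X Y i h => hF.1 _ _ ?_) μ P hP _ hc
  · rw [← Set.disjoint_iff_inter_eq_empty]
    have hX : Subtype.val '' f X =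
        momentCurve d '' ((fun a => ((ι a : ℕ) : ℝ)) '' {a | X a.1 a.2.1 = a.2.2}) := by
      simp only [f, Set.image_image, pt]
    have hY : Subtype.val '' g Y =
        momentCurve d '' (univ.image fun l => ((ι (l, Y l) : ℕ) : ℝ) : Finset ℝ) := by
      rw [coe_image, coe_univ, Set.image_univ, ← Set.range_comp, ← Set.range_comp]
      rfl
    rw [hull, hull, hX, hY]
    refine disjoint_convexHull_momentCurve _ _ ?_ ?_
    · have := card_image_le (s := univ) (f := fun l : Fin k => ((ι (l, Y l) : ℕ) : ℝ))
      rw [card_univ, Fintype.card_fin] at this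
      omega
    · intro y hy
      obtain ⟨l, -, rfl⟩ := mem_image.1 hy
      rintro ⟨a, ha, hal⟩
      have hal' : a = (l, Y l) := ι.injective (Fin.ext (Nat.cast_injective hal))
      subst hal'
      have := congrFun h l
      simp only [hits, noHit, beq_eq_false_iff_ne] at this
      exact this ha
  · refine ⟨pt (i, Y i), ⟨_, ?_, rfl⟩, i, rfl⟩
    have := congrFun h i
    simpa [hits, hitAt] using this

/-- The block size from which on the lower bound for lopsided disjointness holds. -/
noncomputable def minBlockSize : ℕ := ⌈Real.exp 5000⌉₊

theorem log_ge_of_minBlockSize_le {m : ℕ} (h : minBlockSize ≤ m) : 5000 ≤ Real.log m := by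
  have h1 : Real.exp 5000 ≤ m := (Nat.le_ceil _).trans (by exact_mod_cast h)
  rw [Real.le_log_iff_exp_le (lt_of_lt_of_le (Real.exp_pos _) h1)]
  exact h1

/-- Three regimes remain when n > d: k = ⌊d/2⌋ blocks if each can have at least M pairs; otherwise
log (n/d) ≤ log M, and as many blocks of M pairs as fit give a bound linear in d; if not even one
fits, d is bounded and one bit suffices. -/
theorem exists_lower_bound : ∃ C : ℝ, 0 < C ∧ ∀ d n : ℕ, 2 ≤ d → 1 ≤ n →
    ∀ F : Set (momentPoints d n) → Set (momentPoints d n) → Option Bool,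
      SolvesConvexDisjointness F → C * (d * Real.log ((n : ℝ) / d)) ≤ randCC (1 / 3) F := by
  obtain ⟨M, hM⟩ : ∃ M, M = minBlockSize := ⟨_, rfl⟩
  have hlogM : 5000 ≤ Real.log M := log_ge_of_minBlockSize_le hM.ge
  have hM1 : 1 ≤ M := by
    by_contra h
    have : M = 0 := by omega
    norm_num [this] at hlogM
  have hMpos : (0 : ℝ) < M := by exact_mod_cast hM1
  have hlog2 : Real.log 2 ≤ 1 := by linarith [Real.log_two_lt_d9]
  refine ⟨1 / (100000 * M * (Real.log M + 1)), by positivity, fun d n hd hn F hF => ?_⟩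
  have hdpos : (0 : ℝ) < d := by positivity
  have hnpos : (0 : ℝ) < n := by positivity
  rw [div_mul_eq_mul_div, one_mul, div_le_iff₀ (by positivity)]
  have hR0 : (0 : ℝ) ≤ randCC (1 / 3) F := Nat.cast_nonneg _
  have hMge : (1 : ℝ) ≤ M := by exact_mod_cast hM1
  rcases le_or_gt n d with hnd | hnd
  · have : Real.log ((n : ℝ) / d) ≤ 0 := Real.log_nonpos (by positivity)
      (div_le_one_of_le₀ (by exact_mod_cast hnd) hdpos.le)
    have h1 : d * Real.log ((n : ℝ) / d) ≤ 0 := mul_nonpos_of_nonneg_of_nonpos hdpos.le this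
    have h2 : 0 ≤ (randCC (1 / 3) F : ℝ) * (100000 * M * (Real.log M + 1)) := by positivity
    linarith
  have hnd' : (d : ℝ) < n := by exact_mod_cast hnd
  rcases le_or_gt (2 * M * (d / 2)) n with hbig | hsmall
  · set k := d / 2 with hk
    have hk1 : 1 ≤ k := by omega
    set m := n / (2 * k) with hm
    have hmM : M ≤ m := (Nat.le_div_iff_mul_le (by omega)).2 (by linarith)
    have hmk : 2 * m * k ≤ n := by
      have := Nat.div_mul_le_self n (2 * k)
      calc 2 * m * k = m * (2 * k) := by ring
        _ ≤ n := this
    have hlogm := log_ge_of_minBlockSize_le (hM ▸ hmM)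
    have hmain := log_le_randCC hk1 (by omega) hmk hlogm hF
    have hnm : n ≤ 2 * m * d := by
      have h1 := Nat.lt_div_mul_add (a := n) (b := 2 * k) (by omega)
      have h2 : 2 * k ≤ d := by omega
      have h3 : 1 ≤ m := by omega
      have h4 : n / (2 * k) * (2 * k) + 2 * k ≤ m * d + m * d := by nlinarith
      linarith
    have h5 : Real.log ((n : ℝ) / d) ≤ 2 * Real.log m := by
      have hm0 : (0 : ℝ) < m := by
        have : 1 ≤ m := by omega
        exact_mod_cast this
      have : Real.log ((n : ℝ) / d) ≤ Real.log (2 * m) := by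
        refine Real.log_le_log (by positivity) ?_
        rw [div_le_iff₀ hdpos]
        exact_mod_cast hnm
      rw [Real.log_mul two_ne_zero hm0.ne'] at this
      linarith
    -- Uses d ≥ 2, with equality at d = 3.
    have h6 : (d : ℝ) ≤ 3 * k := by
      have : d ≤ 3 * k := by omega
      exact_mod_cast this
    have h7 : d * Real.log ((n : ℝ) / d) ≤ 3 * k * (2 * Real.log m) := by
      refine (mul_le_mul_of_nonneg_left h5 hdpos.le).trans ?_
      exact mul_le_mul_of_nonneg_right h6 (by linarith)
    have h8 : (30000 : ℝ) ≤ 100000 * M * (Real.log M + 1) := by nlinarith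
    have h9 := mul_le_mul_of_nonneg_left h8 hR0
    linarith
  have hlogle : Real.log ((n : ℝ) / d) ≤ Real.log M := by
    refine Real.log_le_log (by positivity) ?_
    rw [div_le_iff₀ hdpos]
    have : n ≤ M * d := by
      have h1 : 2 * (d / 2) ≤ d := by omega
      nlinarith
    exact_mod_cast this
  have hlogle' : d * Real.log ((n : ℝ) / d) ≤ d * Real.log M :=
    mul_le_mul_of_nonneg_left hlogle hdpos.le
  rcases le_or_gt (2 * M) n with hmid | htiny
  · set k := n / (2 * M) with hk
    have hk1 : 1 ≤ k := (Nat.le_div_iff_mul_le (by omega)).2 (by linarith)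
    have hkn : 2 * M * k ≤ n := Nat.mul_div_le _ _
    have hkd : k < d / 2 := by
      by_contra h
      have := Nat.mul_le_mul_left (2 * M) (not_lt.1 h)
      omega
    have hmain := log_le_randCC hk1 (by omega) hkn hlogM hF
    -- Since k ≥ 1, d < n < 2M (k + 1) ≤ 4Mk.
    have hdk : (d : ℝ) ≤ 4 * M * k := by
      have h1 : n < 2 * M * k + 2 * M := Nat.lt_mul_div_succ n (by omega)
      have h2 : d ≤ 4 * M * k := by nlinarith
      exact_mod_cast h2
    have h1 : d * Real.log M ≤ 4 * M * k * Real.log M :=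
      mul_le_mul_of_nonneg_right hdk (by linarith)
    have h2 : (4 * M * k * Real.log M : ℝ) = 20000 * M * (k * Real.log M / 5000) := by ring
    have h3 : 20000 * M * (k * Real.log M / 5000) ≤ 20000 * M * (randCC (1 / 3) F : ℝ) :=
      mul_le_mul_of_nonneg_left hmain (by positivity)
    have h4 : (20000 * M : ℝ) ≤ 100000 * M * (Real.log M + 1) := by nlinarith
    have h5 := mul_le_mul_of_nonneg_left h4 hR0
    linarith
  · have hone : (1 : ℝ) ≤ randCC (1 / 3) F := by
      have : (momentPoints d n).Nonempty := by
        rw [← card_pos, card_momentPoints (by omega)]; omega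
      exact_mod_cast one_le_randCC this hF
    have hdM : (d : ℝ) ≤ 2 * M := by
      have : d ≤ 2 * M := by omega
      exact_mod_cast this
    have h1 : d * Real.log M ≤ 2 * M * Real.log M :=
      mul_le_mul_of_nonneg_right hdM (by linarith)
    have h2 : 2 * M * Real.log M ≤ 100000 * M * (Real.log M + 1) := by nlinarith
    have h3 : 0 ≤ 100000 * M * (Real.log M + 1) := by positivity
    nlinarith

end ConvexSetDisjointness

theorem theorem4 :
    ∃ C : ℝ, 0 < C ∧ ∀ d n : ℕ, 2 ≤ d → 1 ≤ n →
      ∃ U : Finset (Fin d → ℝ), U.card = n ∧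
        C * (d * Real.log ((n : ℝ) / d)) ≤
          (ConvexSetDisjointness.randCC (1 / 3) (ConvexSetDisjointness.PromiseCSD U) : ℝ) ∧
        C * (d * Real.log ((n : ℝ) / d)) ≤
          (ConvexSetDisjointness.randCC (1 / 3) (ConvexSetDisjointness.CSD U) : ℝ) := by
  obtain ⟨C, hC, h⟩ := ConvexSetDisjointness.exists_lower_bound
  exact ⟨C, hC, fun d n hd hn => ⟨ConvexSetDisjointness.momentPoints d n,
    ConvexSetDisjointness.card_momentPoints (by omega) n,
    h d n hd hn _ (ConvexSetDisjointness.solves_PromiseCSD _),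
    h d n hd hn _ (ConvexSetDisjointness.solves_CSD _)⟩⟩
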